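/- Let $m\ge 0$, $n\ge 1$, let $U\subseteq\mathbb R\times\mathbb R^m$ be open and let $u:U\to\mathbb R$, $(t,x)\mapsto u(t,x)$, be continuously differentiable. Let $G=(g_1,\dots,g_n)=(u_{\alpha_1},\dots,u_{\alpha_n})$, where $u_{\alpha_i}$ is the spatial partial derivative of $u$ with multi-index $\alpha_i\in\mathbb N^m$; assume that these derivatives exist and are differentiable on $U$, and let $J_G(p)\in\mathbb R^{(m+1)\times n}$ be the Jacobian of $G$ at $p\in U$, written with one column per function $g_i$. For a set $V$ of functions $\mathbb R^n\to\mathbb R$ suppose that some $F\in V$ satisfies $\frac{\partial u}{\partial t}(t,x)=F(G(t,x))$ for all $(t,x)\in U$. The PDE described by $V$ is *unique* (for $u$ and $G$) if there is exactly one such $F\in V$, and *not unique* if there are several. An *analytic PDE* is one with $V$ the set of real-analytic functions $\mathbb R^n\to\mathbb R$; an *algebraic PDE* is one with $V$ the set of real-analytic functions on $\mathbb R^n$ that are algebraic. A function $f$ is *algebraic* if there is a nonzero real polynomial $P$ with $P(x,f(x))=0$ for all $x$ in its domain. For a matrix $A$ with $n$ columns, let $\sigma_1(A)\ge\dots\ge\sigma_n(A)\ge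 0$ be its $n$ singular values (the square roots of the eigenvalues of $A^{\mathsf T}A$), and $\rho(A)=\sigma_n(A)/\sigma_1(A)$ if $A\neq 0$. Let $D\subseteq U$ be a set of data points, and for each $p\in D$ let $J_{\tilde G}(p)\in\mathbb R^{(m+1)\times n}$ be a matrix (the Jacobian computed from noisy data) with $\|J_G(p)-J_{\tilde G}(p)\|_F\le\epsilon_{J_G}$. Suppose that $C_1^{low}\le\sigma_1(J_G(p))\le C_1^{up}$ for all $p\in D$. 1. If the analytic PDE is not unique, or if $u$ is algebraic and the algebraic PDE is not unique, and if $C_1^{low}>\epsilon_{J_G}$, then for every data point $p\in D$ one has $J_{\tilde G}(p)\ne 0$ and $$\rho(J_{\tilde G}(p))\le\frac{\epsilon_{J_G}}{C_1^{low}-\epsilon_{J_G}}.$$ 2. If $u$ is algebraic, the algebraic PDE is unique, $C_n>\epsilon_{J_G}$, and $C_n$ is a lower bound for $\sigma_n(J_G)$ in the following sense: if $J_G$ has full rank $n$ at some point of $U$, then $\sigma_n(J_G(p))\ge C_n$ for at least one data point $p\in D$ (this holds, for example, if $D\ne\emptyset$ and $\sigma_n(J_G(p))\ge C_n$ for all $p\in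 D$, or if $D=U$ and $\sigma_n(J_G(p))\ge C_n$ for all $p\in U$ at which $J_G(p)$ has full rank $n$), then for at least one data point $p\in D$ one has $J_{\tilde G}(p)\neq 0$ and $$\rho(J_{\tilde G}(p))\ge\frac{C_n-\epsilon_{J_G}}{C_1^{up}+\epsilon_{J_G}}.$$ -/

import Mathlib

open scoped Matrix.Norms.Frobenius

noncomputable section

/-- The partial derivative `∂f/∂p_j` of a function of finitely many real variables. -/
def partialDeriv {k : ℕ} (f : (Fin k → ℝ) → ℝ) (j : Fin k) (p : Fin k → ℝ) : ℝ :=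
  fderiv ℝ f p (Pi.single j 1)

/-- Points of `ℝ × ℝ^m` are written `(t, x_1, …, x_m) : Fin (m + 1) → ℝ`, with the time at index `0`.
`IsSpatialDeriv U u α f` says that, on `U`, the function `f` is the spatial derivative `u_α` of `u`:
it is reached from `u` by `α_j` partial differentiations in `x_j` for each `j`, taken in some order,
where each derivative on the way exists at all points of `U`. -/
inductive IsSpatialDeriv {m : ℕ} (U : Set (Fin (m + 1) → ℝ)) (u : (Fin (m + 1) → ℝ) → ℝ) :
    (Fin m → ℕ) → ((Fin (m + 1) → ℝ) → ℝ) → Prop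
  | zero : IsSpatialDeriv U u 0 u
  | step (α : Fin m → ℕ) (f g : (Fin (m + 1) → ℝ) → ℝ) (j : Fin m) :
      IsSpatialDeriv U u α f →
      (∀ p ∈ U, HasLineDerivAt ℝ f (g p) p (Pi.single j.succ 1)) →
      IsSpatialDeriv U u (α + Pi.single j 1) g

/-- `f` is an algebraic function on `S`: it satisfies `P(x, f(x)) = 0` for all `x ∈ S`, for some
nonzero polynomial `P` in the variables `x_1, …, x_k` and one further variable. -/
def IsAlgebraicOn {k : ℕ} (f : (Fin k → ℝ) → ℝ) (S : Set (Fin k → ℝ)) : Prop :=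
  ∃ P : Polynomial (MvPolynomial (Fin k) ℝ), P ≠ 0 ∧
    ∀ x ∈ S, (P.map (MvPolynomial.eval x)).eval (f x) = 0

/-- The class of analytic functions `ℝ^n → ℝ`: right-hand sides of analytic PDEs. -/
def analyticClass (n : ℕ) : Set ((Fin n → ℝ) → ℝ) :=
  {F | AnalyticOnNhd ℝ F Set.univ}

/-- The class of (analytic) algebraic functions `ℝ^n → ℝ`: right-hand sides of algebraic PDEs. -/
def algebraicClass (n : ℕ) : Set ((Fin n → ℝ) → ℝ) :=
  {F | AnalyticOnNhd ℝ F Set.univ ∧ IsAlgebraicOn F Set.univ}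

/-- `u` solves the PDE `∂u/∂t = F(g_1, …, g_n)` on `U`. -/
def SolvesPDE {m n : ℕ} (U : Set (Fin (m + 1) → ℝ)) (u : (Fin (m + 1) → ℝ) → ℝ)
    (G : Fin n → (Fin (m + 1) → ℝ) → ℝ) (F : (Fin n → ℝ) → ℝ) : Prop :=
  ∀ p ∈ U, partialDeriv u 0 p = F (fun i => G i p)

/-- `u` solves a unique PDE described by functions in `V` for `G`. -/
def SolvesUniquePDE {m n : ℕ} (V : Set ((Fin n → ℝ) → ℝ)) (U : Set (Fin (m + 1) → ℝ))
    (u : (Fin (m + 1) → ℝ) → ℝ) (G : Fin n → (Fin (m + 1) → ℝ) → ℝ) : Prop :=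
  ∃! F : (Fin n → ℝ) → ℝ, F ∈ V ∧ SolvesPDE U u G F

/-- `u` solves a PDE described by a function in `V` for `G`, but that PDE is not unique. -/
def SolvesNonuniquePDE {m n : ℕ} (V : Set ((Fin n → ℝ) → ℝ)) (U : Set (Fin (m + 1) → ℝ))
    (u : (Fin (m + 1) → ℝ) → ℝ) (G : Fin n → (Fin (m + 1) → ℝ) → ℝ) : Prop :=
  (∃ F : (Fin n → ℝ) → ℝ, F ∈ V ∧ SolvesPDE U u G F) ∧ ¬ SolvesUniquePDE V U u G

/-- The Jacobian `J_G(p)`, with one column per function `g_i` and one row per coordinate. -/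
def jacobian {k n : ℕ} (G : Fin n → (Fin k → ℝ) → ℝ) (p : Fin k → ℝ) :
    Matrix (Fin k) (Fin n) ℝ :=
  Matrix.of fun j i => partialDeriv (G i) j p

/-- The `i`-th singular value `σ_i(A)`, for `i = 1, 2, …`, in decreasing order. -/
def sigma {k n : ℕ} (A : Matrix (Fin k) (Fin n) ℝ) (i : ℕ) : ℝ :=
  (Matrix.toEuclideanLin A).singularValues (i - 1)

/-- `ρ(A) = σ_n(A) / σ_1(A)` for a nonzero matrix `A` with `n` columns. -/
def rho {k n : ℕ} (A : Matrix (Fin k) (Fin n) ℝ) : ℝ :=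
  sigma A n / sigma A 1

end

/-! Non-uniqueness of the PDE and rank deficiency of the Jacobian are linked by relations between
the `g_i`. Two right-hand sides differ by a nonzero analytic `H` with `H ∘ G = 0` on `U`. At a point
of full column rank the derivative of `G` is onto, so the homogeneous Taylor terms of `H` vanish one
degree after another, and the identity theorem gives `H = 0`. Hence the rank is deficient on all of
`U` (`jacobian_rank_ne_of_analytic_relation`).

Conversely, let `u` be algebraic and the rank deficient on all of `U`. By implicit differentiation
the `g_i` are generically algebraic. Over a field of characteristic zero, derivations take arbitrary
values on algebraically independent elements; the chain rule would then make the Jacobian columns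
independent. So `Q(G) = 0` for some polynomial `Q ≠ 0` (`exists_polynomial_relation`), and `F + Q`
is a second algebraic right-hand side. The fields needed are germs along ultrafilters of generic
points; a compactness argument combines their relations into one.

The bounds on `ρ` follow since `σ_1` and `σ_n` move by at most the Frobenius norm of the
perturbation (`sigma_one_le_add`, `sigma_last_le_add`), and `σ_n = 0` when the rank is deficient. -/

/-! ### Singular values under perturbation -/

theorem LinearMap.sq_norm_apply_eq_sum_singularValues {E F : Type*} [NormedAddCommGroup E]
    [InnerProductSpace ℝ E] [FiniteDimensional ℝ E] [NormedAddCommGroup F] [InnerProductSpace ℝ F]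
    [FiniteDimensional ℝ F] (T : E →ₗ[ℝ] F) {n : ℕ} (hn : Module.finrank ℝ E = n) (x : E) :
    ‖T x‖ ^ 2 = ∑ i : Fin n, T.singularValues i ^ 2 *
      (T.isSymmetric_adjoint_comp_self.eigenvectorBasis hn).repr x i ^ 2 := by
  set b := T.isSymmetric_adjoint_comp_self.eigenvectorBasis hn with hb
  have h1 : ‖T x‖ ^ 2 = inner ℝ x ((LinearMap.adjoint T ∘ₗ T) x) := by
    rw [LinearMap.comp_apply, LinearMap.adjoint_inner_right, real_inner_self_eq_norm_sq]
  rw [h1, ← b.repr.inner_map_map, PiLp.inner_apply]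
  refine Finset.sum_congr rfl fun i _ => ?_
  rw [LinearMap.IsSymmetric.eigenvectorBasis_apply_self_apply, T.sq_singularValues_fin hn]
  simp only [← hb, RCLike.inner_apply, conj_trivial, RCLike.ofReal_real_eq_id, _root_.id]
  ring

theorem LinearMap.norm_apply_le_singularValues_zero {E F : Type*} [NormedAddCommGroup E]
    [InnerProductSpace ℝ E] [FiniteDimensional ℝ E] [NormedAddCommGroup F] [InnerProductSpace ℝ F]
    [FiniteDimensional ℝ F] (T : E →ₗ[ℝ] F) (x : E) :
    ‖T x‖ ≤ T.singularValues 0 * ‖x‖ := by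
  refine le_of_sq_le_sq ?_ (mul_nonneg (T.singularValues_nonneg 0) (norm_nonneg x))
  rw [T.sq_norm_apply_eq_sum_singularValues rfl, mul_pow,
    ← (T.isSymmetric_adjoint_comp_self.eigenvectorBasis rfl).repr.norm_map x,
    EuclideanSpace.real_norm_sq_eq, Finset.mul_sum]
  refine Finset.sum_le_sum fun i _ => mul_le_mul_of_nonneg_right ?_ (sq_nonneg _)
  exact pow_le_pow_left₀ (T.singularValues_nonneg _) (T.singularValues_antitone (Nat.zero_le _)) 2

theorem LinearMap.singularValues_pred_finrank_mul_norm_le {E F : Type*} [NormedAddCommGroup E]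
    [InnerProductSpace ℝ E] [FiniteDimensional ℝ E] [NormedAddCommGroup F] [InnerProductSpace ℝ F]
    [FiniteDimensional ℝ F] (T : E →ₗ[ℝ] F) {n : ℕ} (hn : Module.finrank ℝ E = n) (x : E) :
    T.singularValues (n - 1) * ‖x‖ ≤ ‖T x‖ := by
  refine le_of_sq_le_sq ?_ (norm_nonneg _)
  rw [T.sq_norm_apply_eq_sum_singularValues hn, mul_pow,
    ← (T.isSymmetric_adjoint_comp_self.eigenvectorBasis hn).repr.norm_map x,
    EuclideanSpace.real_norm_sq_eq, Finset.mul_sum]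
  refine Finset.sum_le_sum fun i _ => mul_le_mul_of_nonneg_right ?_ (sq_nonneg _)
  exact pow_le_pow_left₀ (T.singularValues_nonneg _)
    (T.singularValues_antitone (Nat.le_sub_one_of_lt i.2)) 2

theorem LinearMap.exists_norm_apply_eq_singularValues {E F : Type*} [NormedAddCommGroup E]
    [InnerProductSpace ℝ E] [FiniteDimensional ℝ E] [NormedAddCommGroup F] [InnerProductSpace ℝ F]
    [FiniteDimensional ℝ F] (T : E →ₗ[ℝ] F) {n : ℕ} (hn : Module.finrank ℝ E = n) (i : Fin n) :
    ∃ x : E, ‖x‖ = 1 ∧ ‖T x‖ = T.singularValues i := by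
  refine ⟨T.isSymmetric_adjoint_comp_self.eigenvectorBasis hn i, OrthonormalBasis.norm_eq_one _ i,
    ?_⟩
  rw [← sq_eq_sq₀ (norm_nonneg _) (T.singularValues_nonneg _),
    T.sq_norm_apply_eq_sum_singularValues hn, Finset.sum_eq_single i]
  · simp
  · intro j _ hj
    simp [hj]
  · simp

/-- Cauchy–Schwarz applied to each row. -/
theorem Matrix.norm_toEuclideanLin_le {k n : ℕ} (A : Matrix (Fin k) (Fin n) ℝ)
    (x : EuclideanSpace ℝ (Fin n)) : ‖Matrix.toEuclideanLin A x‖ ≤ ‖A‖ * ‖x‖ := by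
  refine le_of_sq_le_sq ?_ (mul_nonneg (norm_nonneg _) (norm_nonneg x))
  have hA : ‖A‖ ^ 2 = ∑ i, ∑ j, A i j ^ 2 := by
    rw [Matrix.frobenius_norm_def, ← Real.sqrt_eq_rpow, Real.sq_sqrt (by positivity)]
    simp
  rw [mul_pow, hA, EuclideanSpace.real_norm_sq_eq, EuclideanSpace.real_norm_sq_eq, Finset.sum_mul]
  refine Finset.sum_le_sum fun i _ => ?_
  simpa [Matrix.toLpLin_apply, Matrix.mulVec, dotProduct] using
    Finset.sum_mul_sq_le_sq_mul_sq Finset.univ (A i) x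

theorem sigma_nonneg {k n : ℕ} (A : Matrix (Fin k) (Fin n) ℝ) (i : ℕ) : 0 ≤ sigma A i :=
  LinearMap.singularValues_nonneg _ _

/-- Both matrices are tested on a unit vector where `A` attains its largest singular value. -/
theorem sigma_one_le_add {k n : ℕ} (hn : 0 < n) (A B : Matrix (Fin k) (Fin n) ℝ) :
    sigma A 1 ≤ sigma B 1 + ‖A - B‖ := by
  obtain ⟨x, hx, hAx⟩ := (Matrix.toEuclideanLin A).exists_norm_apply_eq_singularValues
    (finrank_euclideanSpace_fin (𝕜 := ℝ)) ⟨0, hn⟩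
  have h1 := (Matrix.toEuclideanLin B).norm_apply_le_singularValues_zero x
  have h2 := Matrix.norm_toEuclideanLin_le (A - B) x
  have h3 : Matrix.toEuclideanLin A x =
      Matrix.toEuclideanLin B x + Matrix.toEuclideanLin (A - B) x := by simp
  rw [hx, mul_one] at h1 h2
  calc sigma A 1 = ‖Matrix.toEuclideanLin A x‖ := hAx.symm
    _ ≤ _ := by rw [h3]; exact (norm_add_le _ _).trans (add_le_add h1 h2)

theorem sigma_last_le_add {k n : ℕ} (hn : 0 < n) (A B : Matrix (Fin k) (Fin n) ℝ) :
    sigma A n ≤ sigma B n + ‖A - B‖ := by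
  -- The test vector belongs to `B` here, since `σ_n` is a minimum over unit vectors. Singular
  -- values are indexed from zero, so the last has index `n - 1`.
  obtain ⟨x, hx, hBx⟩ := (Matrix.toEuclideanLin B).exists_norm_apply_eq_singularValues
    (finrank_euclideanSpace_fin (𝕜 := ℝ)) ⟨n - 1, Nat.sub_one_lt hn.ne'⟩
  have h1 := (Matrix.toEuclideanLin A).singularValues_pred_finrank_mul_norm_le
    (finrank_euclideanSpace_fin (𝕜 := ℝ)) x
  have h2 := Matrix.norm_toEuclideanLin_le (A - B) x
  have h3 : Matrix.toEuclideanLin A x =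
      Matrix.toEuclideanLin B x + Matrix.toEuclideanLin (A - B) x := by simp
  rw [hx, mul_one] at h1 h2
  calc sigma A n ≤ ‖Matrix.toEuclideanLin A x‖ := h1
    _ ≤ ‖Matrix.toEuclideanLin B x‖ + ‖A - B‖ := by
      rw [h3]; exact (norm_add_le _ _).trans (add_le_add_right h2 _)
    _ = _ := by rw [hBx]; rfl

theorem sigma_last_le_sigma_one {k n : ℕ} (A : Matrix (Fin k) (Fin n) ℝ) :
    sigma A n ≤ sigma A 1 :=
  (Matrix.toEuclideanLin A).singularValues_antitone (Nat.zero_le (n - 1))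

theorem sigma_zero {k n : ℕ} (i : ℕ) : sigma (0 : Matrix (Fin k) (Fin n) ℝ) i = 0 := by
  simp [sigma]

theorem Matrix.exists_mulVec_eq_zero_of_rank_ne {k n : ℕ} (A : Matrix (Fin k) (Fin n) ℝ)
    (h : A.rank ≠ n) : ∃ c : Fin n → ℝ, c ≠ 0 ∧ A.mulVec c = 0 := by
  by_contra! hc
  refine h ?_
  have hinj : Function.Injective A.mulVecLin := by
    rw [injective_iff_map_eq_zero]
    intro c hc'
    by_contra h0
    exact hc c h0 hc'
  rw [Matrix.rank, LinearMap.finrank_range_of_inj hinj, Module.finrank_fin_fun]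

theorem sigma_last_eq_zero_of_rank_ne {k n : ℕ} (A : Matrix (Fin k) (Fin n) ℝ)
    (h : A.rank ≠ n) : sigma A n = 0 := by
  obtain ⟨c, hc, hAc⟩ := A.exists_mulVec_eq_zero_of_rank_ne h
  have h1 := (Matrix.toEuclideanLin A).singularValues_pred_finrank_mul_norm_le
    (finrank_euclideanSpace_fin (𝕜 := ℝ)) (WithLp.toLp 2 c)
  have h2 : Matrix.toEuclideanLin A (WithLp.toLp 2 c) = 0 := by
    simp [Matrix.toLpLin_apply, hAc]
  rw [h2, norm_zero] at h1
  have h3 : 0 < ‖WithLp.toLp 2 c‖ := by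
    rw [norm_pos_iff]; simpa using hc
  exact le_antisymm (nonpos_of_mul_nonpos_left h1 h3) (sigma_nonneg A n)

/-- The Jacobian has one column per feature, so the derivative of `G` acts by row vectors: full
column rank means that it is onto. -/
theorem Matrix.exists_vecMul_eq_of_rank_eq {k n : ℕ} (A : Matrix (Fin k) (Fin n) ℝ)
    (h : A.rank = n) (y : Fin n → ℝ) : ∃ w : Fin k → ℝ, A.vecMul w = y := by
  have h1 : LinearMap.range A.transpose.mulVecLin = ⊤ := by
    apply Submodule.eq_top_of_finrank_eq
    rw [Module.finrank_fin_fun]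
    exact (Matrix.rank_transpose A).trans h
  obtain ⟨w, hw⟩ := LinearMap.range_eq_top.1 h1 y
  exact ⟨w, by simpa [Matrix.mulVec_transpose] using hw⟩

theorem rho_le_of_rank_ne {k n : ℕ} (hn : 0 < n) {A B : Matrix (Fin k) (Fin n) ℝ} {ε C : ℝ}
    (hA : A.rank ≠ n) (hC : C ≤ sigma A 1) (hε : ‖A - B‖ ≤ ε) (hεC : ε < C) :
    B ≠ 0 ∧ rho B ≤ ε / (C - ε) := by
  have h1 := sigma_one_le_add hn A B
  have h2 := sigma_last_le_add hn B A
  rw [sigma_last_eq_zero_of_rank_ne A hA, norm_sub_rev] at h2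
  have h3 : C - ε ≤ sigma B 1 := by linarith
  refine ⟨?_, ?_⟩
  · rintro rfl
    rw [sigma_zero] at h3
    linarith
  · exact div_le_div₀ ((norm_nonneg _).trans hε) (by linarith) (by linarith) h3

theorem le_rho_of_le_sigma_last {k n : ℕ} (hn : 0 < n) {A B : Matrix (Fin k) (Fin n) ℝ}
    {ε C C' : ℝ} (hC : C ≤ sigma A n) (hC' : sigma A 1 ≤ C') (hε : ‖A - B‖ ≤ ε) (hεC : ε < C) :
    B ≠ 0 ∧ (C - ε) / (C' + ε) ≤ rho B := by
  have h1 := sigma_last_le_add hn A B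
  have h2 := sigma_one_le_add hn B A
  rw [norm_sub_rev] at h2
  -- Makes the denominator `σ_1(B)` positive, since `σ_n(B) ≥ C - ε > 0`.
  have h3 := sigma_last_le_sigma_one B
  refine ⟨?_, ?_⟩
  · rintro rfl
    rw [sigma_zero] at h1
    linarith
  · exact div_le_div₀ (sigma_nonneg B n) (by linarith) (by linarith) (by linarith)

/-! ### Analytic relations force rank deficiency -/

open Filter Topology Asymptotics in
/-- An analytic function that vanishes along a map with surjective derivative at `p` vanishes
near the image of `p`; the map need not be strictly differentiable. -/
theorem AnalyticAt.eventually_eq_zero_of_comp {E F : Type*} [NormedAddCommGroup E]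
    [NormedSpace ℝ E] [NormedAddCommGroup F] [NormedSpace ℝ F] {H : F → ℝ} {G : E → F}
    {G' : E →L[ℝ] F} {p : E} (hH : AnalyticAt ℝ H (G p)) (hG : HasFDerivAt G G' p)
    (hsurj : Function.Surjective G') (h0 : ∀ᶠ x in 𝓝 p, H (G x) = 0) :
    ∀ᶠ y in 𝓝 (G p), H y = 0 := by
  obtain ⟨ps, hps⟩ := hH
  have key : ∀ d : ℕ, ∀ y : F, ps d (fun _ => y) = 0 := by
    intro d
    induction d using Nat.strong_induction_on with
    | _ d ih =>
      intro y
      obtain ⟨w, rfl⟩ := hsurj y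
      have hline : HasDerivAt (fun s : ℝ => G (p + s • w)) (G' w) 0 := hG.hasLineDerivAt w
      have hslope : Tendsto (fun s : ℝ => s⁻¹ • (G (p + s • w) - G p)) (𝓝[≠] 0) (𝓝 (G' w)) := by
        simpa using hasDerivAt_iff_tendsto_slope_zero.1 hline
      have hv : Tendsto (fun s : ℝ => G (p + s • w) - G p) (𝓝[≠] 0) (𝓝 0) := by
        have h1 : Tendsto (fun s : ℝ => G (p + s • w) - G p) (𝓝 0)
            (𝓝 (G (p + (0 : ℝ) • w) - G p)) := hline.continuousAt.tendsto.sub_const _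
        rw [zero_smul, add_zero, sub_self] at h1
        exact h1.mono_left nhdsWithin_le_nhds
      have hx : Tendsto (fun s : ℝ => p + s • w) (𝓝[≠] 0) (𝓝 p) := by
        have h1 : Tendsto (fun s : ℝ => p + s • w) (𝓝 0) (𝓝 (p + (0 : ℝ) • w)) :=
          (continuous_const.add (continuous_id.smul continuous_const)).tendsto 0
        rw [zero_smul, add_zero] at h1
        exact h1.mono_left nhdsWithin_le_nhds
      -- Lower terms vanish by induction and `H ∘ G = 0`, so the degree `d` term at the increment of
      -- `G` is of order `d + 1` in it. Division by `s ^ d` leaves one factor tending to zero.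
      obtain ⟨C, hC⟩ := (hps.isBigO_sub_partialSum_pow (d + 1)).bound
      have hbound : ∀ᶠ s : ℝ in 𝓝[≠] 0,
          ‖ps d (fun _ => s⁻¹ • (G (p + s • w) - G p))‖ ≤
            C * ‖s⁻¹ • (G (p + s • w) - G p)‖ ^ d * ‖G (p + s • w) - G p‖ := by
        filter_upwards [hv.eventually hC, hx.eventually h0, self_mem_nhdsWithin] with s hs1 hs2 hs3
        have hsum : ps.partialSum (d + 1) (G (p + s • w) - G p) =
            ps d (fun _ => G (p + s • w) - G p) := by
          rw [FormalMultilinearSeries.partialSum, Finset.sum_range_succ,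
            Finset.sum_eq_zero fun i hi => ih i (Finset.mem_range.1 hi) _, zero_add]
        rw [hsum, add_sub_cancel, hs2, zero_sub, norm_neg, norm_pow, norm_norm] at hs1
        have hmul : ps d (fun _ => s⁻¹ • (G (p + s • w) - G p)) =
            s⁻¹ ^ d * ps d (fun _ => G (p + s • w) - G p) := by
          have := (ps d).map_smul_univ (fun _ => s⁻¹) (fun _ => G (p + s • w) - G p)
          simpa using this
        rw [hmul, norm_mul, norm_smul, norm_pow, mul_pow]
        calc ‖s⁻¹‖ ^ d * ‖ps d fun _ => G (p + s • w) - G p‖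
            ≤ ‖s⁻¹‖ ^ d * (C * ‖G (p + s • w) - G p‖ ^ (d + 1)) :=
              mul_le_mul_of_nonneg_left hs1 (by positivity)
          _ = _ := by ring
      have hlim : Tendsto (fun s : ℝ => C * ‖s⁻¹ • (G (p + s • w) - G p)‖ ^ d *
          ‖G (p + s • w) - G p‖) (𝓝[≠] 0) (𝓝 0) := by
        have := ((hslope.norm.pow d).const_mul C).mul hv.norm
        simpa using this
      have hcont : Tendsto (fun s : ℝ => ps d (fun _ => s⁻¹ • (G (p + s • w) - G p))) (𝓝[≠] 0)
          (𝓝 (ps d (fun _ => G' w))) :=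
        ((ps d).cont.tendsto _).comp (tendsto_pi_nhds.2 fun _ => hslope)
      exact tendsto_nhds_unique hcont (squeeze_zero_norm' hbound hlim)
  -- Vanishing on the diagonal suffices: the power series only evaluates its terms there.
  filter_upwards [hps.eventually_hasSum_sub] with y hy
  simp only [key] at hy
  exact hy.unique hasSum_zero

theorem hasFDerivAt_features {k n : ℕ} {G : Fin n → (Fin k → ℝ) → ℝ} {p : Fin k → ℝ}
    (hG : ∀ i, DifferentiableAt ℝ (G i) p) :
    HasFDerivAt (fun x i => G i x) (ContinuousLinearMap.pi fun i => fderiv ℝ (G i) p) p :=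
  hasFDerivAt_pi.2 fun i => (hG i).hasFDerivAt

theorem fderiv_eq_vecMul_jacobian {k n : ℕ} (G : Fin n → (Fin k → ℝ) → ℝ) (p w : Fin k → ℝ) :
    (ContinuousLinearMap.pi fun i => fderiv ℝ (G i) p) w = (jacobian G p).vecMul w := by
  ext i
  have h : fderiv ℝ (G i) p w = ∑ j, w j * fderiv ℝ (G i) p (Pi.single j 1) := by
    conv_lhs => rw [pi_eq_sum_univ' w, map_sum]
    refine Finset.sum_congr rfl fun j _ => ?_
    rw [map_smul, smul_eq_mul]
  simp [h, Matrix.vecMul, dotProduct, jacobian, partialDeriv]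

/-- The identity theorem is applied on all of `ℝ^n`, so `U` need not be connected. -/
theorem jacobian_rank_ne_of_analytic_relation {k n : ℕ} {U : Set (Fin k → ℝ)} (hU : IsOpen U)
    {G : Fin n → (Fin k → ℝ) → ℝ} (hG : ∀ i, DifferentiableOn ℝ (G i) U)
    {H : (Fin n → ℝ) → ℝ} (hH : AnalyticOnNhd ℝ H Set.univ) (hH0 : H ≠ 0)
    (h : ∀ p ∈ U, H (fun i => G i p) = 0) {p : Fin k → ℝ} (hp : p ∈ U) :
    (jacobian G p).rank ≠ n := by
  intro hr
  refine hH0 ?_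
  have hev := AnalyticAt.eventually_eq_zero_of_comp (G := fun x i => G i x)
    (hH (fun i => G i p) (Set.mem_univ _))
    (hasFDerivAt_features fun i => (hG i).differentiableAt (hU.mem_nhds hp))
    (fun y => by
      obtain ⟨w, hw⟩ := (jacobian G p).exists_vecMul_eq_of_rank_eq hr y
      exact ⟨w, by rw [fderiv_eq_vecMul_jacobian, hw]⟩)
    (Filter.eventually_of_mem (hU.mem_nhds hp) h)
  have := hH.eqOn_zero_of_preconnected_of_eventuallyEq_zero isPreconnected_univ
    (Set.mem_univ _) hev
  ext y
  exact this (Set.mem_univ y)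

theorem SolvesNonuniquePDE.jacobian_rank_ne {m n : ℕ} {U : Set (Fin (m + 1) → ℝ)} (hU : IsOpen U)
    {u : (Fin (m + 1) → ℝ) → ℝ} {G : Fin n → (Fin (m + 1) → ℝ) → ℝ}
    (hG : ∀ i, DifferentiableOn ℝ (G i) U) {V : Set ((Fin n → ℝ) → ℝ)} (hV : V ⊆ analyticClass n)
    (h : SolvesNonuniquePDE V U u G) {p : Fin (m + 1) → ℝ} (hp : p ∈ U) :
    (jacobian G p).rank ≠ n := by
  obtain ⟨⟨F, hF, hFu⟩, hne⟩ := h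
  obtain ⟨F', ⟨hF', hFu'⟩, hFF'⟩ :
      ∃ F', (F' ∈ V ∧ SolvesPDE U u G F') ∧ F' ≠ F := by
    by_contra! hc
    exact hne ⟨F, ⟨hF, hFu⟩, hc⟩
  refine jacobian_rank_ne_of_analytic_relation hU hG (H := F' - F) ((hV hF').sub (hV hF))
    (sub_ne_zero.2 hFF') (fun x hx => ?_) hp
  rw [Pi.sub_apply, ← hFu x hx, ← hFu' x hx, sub_self]

/-! ### Derivations and algebraic independence -/

theorem Derivation.map_mvPolynomial_aeval {F L σ : Type*} [CommRing F] [CommRing L] [Algebra F L]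
    [Fintype σ] (δ : Derivation F L L) (f : σ → L) (p : MvPolynomial σ F) :
    δ (MvPolynomial.aeval f p) =
      ∑ i, MvPolynomial.aeval f (MvPolynomial.pderiv i p) * δ (f i) := by
  classical
  induction p using MvPolynomial.induction_on with
  | C a => simp
  | add p q hp hq => simp [hp, hq, add_mul, Finset.sum_add_distrib]
  | mul_X p i hp =>
    simp only [map_mul, MvPolynomial.aeval_X, Derivation.leibniz, hp, smul_eq_mul, map_add,
      MvPolynomial.pderiv_X, add_mul, Finset.sum_add_distrib, Finset.mul_sum, Pi.single_apply,
      apply_ite (MvPolynomial.aeval f), map_one, map_zero]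
    congr 1
    · simp
    · exact Finset.sum_congr rfl fun j _ => by ring

open TensorProduct in
/-- Derivations extend uniquely along formally étale algebras; this is the existence part. -/
theorem Derivation.exists_extension_of_formallyEtale {F S L : Type*} [CommRing F] [CommRing S]
    [CommRing L] [Algebra F S] [Algebra F L] [Algebra S L] [IsScalarTower F S L]
    [Algebra.FormallyEtale S L] (d : Derivation F S L) :
    ∃ δ : Derivation F L L, ∀ s, δ (algebraMap S L s) = d s := by
  -- Formal étaleness identifies `L ⊗[S] Ω[S⁄F]` with `Ω[L⁄F]`, so the linear form of `d` becomes a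
  -- derivation of `L`.
  let φ : L ⊗[S] (Ω[S⁄F]) →ₗ[L] L := (d.liftKaehlerDifferential).liftBaseChange L
  refine ⟨(φ ∘ₗ (KaehlerDifferential.tensorKaehlerEquivOfFormallyEtale F S L).symm.toLinearMap).compDer
    (KaehlerDifferential.D F L), fun s => ?_⟩
  simp [φ, KaehlerDifferential.tensorKaehlerEquivOfFormallyEtale_symm_D_algebraMap]

/-- After completing `g` to a transcendence basis, `L` is algebraic over the rational functions in
it, hence separable in characteristic zero. Localization and separable extension are both formally
étale, so derivations of the polynomial ring extend. -/
theorem AlgebraicIndependent.exists_derivation {F L ι : Type*} [Field F] [CharZero F] [Field L]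
    [Algebra F L] {g : ι → L} (hg : AlgebraicIndependent F g) (v : ι → L) :
    ∃ δ : Derivation F L L, ∀ i, δ (g i) = v i := by
  classical
  obtain ⟨t, hst, ht⟩ := exists_isTranscendenceBasis_superset hg.coe_range
  let S := MvPolynomial t F
  let : Algebra S L := (MvPolynomial.aeval ((↑) : t → L)).toAlgebra
  have : IsScalarTower F S L := IsScalarTower.of_algebraMap_eq'
    (AlgHom.comp_algebraMap (MvPolynomial.aeval ((↑) : t → L))).symm
  have hinj : Function.Injective (algebraMap S L) := ht.1
  have : FaithfulSMul S L := (faithfulSMul_iff_algebraMap_injective S L).2 hinj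
  have : Algebra.IsAlgebraic (Algebra.adjoin F (Set.range ((↑) : t → L))) L := ht.isAlgebraic
  have : Algebra.IsAlgebraic S L := Algebra.IsAlgebraic.of_ringHom_of_comp_eq
    (ht.1.aevalEquiv : S ≃ₐ[F] _) (RingHom.id L) (EquivLike.surjective _)
    Function.injective_id (RingHom.ext fun _ => rfl)
  let K := FractionRing S
  let : Algebra K L := FractionRing.liftAlgebra S L
  have : Algebra.IsAlgebraic K L := IsFractionRing.comap_isAlgebraic_iff (A := S).1 inferInstance
  have : CharZero K := charZero_of_injective_algebraMap
    ((IsFractionRing.injective S K).comp (MvPolynomial.C_injective t F) :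
      Function.Injective ((algebraMap S K).comp MvPolynomial.C))
  have : Algebra.FormallyEtale K L := Algebra.FormallyEtale.of_isSeparable K L
  have : Algebra.FormallyEtale S K := Algebra.FormallyEtale.of_isLocalization (nonZeroDivisors S)
  have : Algebra.FormallyEtale S L := Algebra.FormallyEtale.comp S K L
  obtain ⟨δ, hδ⟩ := Derivation.exists_extension_of_formallyEtale
    -- The basis elements outside the range of `g` get the value zero; on the range the choice is
    -- unambiguous because `g` is injective.
    (MvPolynomial.mkDerivation F fun x : t =>
      if h : ∃ i, g i = x then v h.choose else 0 : Derivation F S L)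
  refine ⟨δ, fun i => ?_⟩
  have h := hδ (MvPolynomial.X ⟨g i, hst ⟨i, rfl⟩⟩)
  rw [MvPolynomial.mkDerivation_X] at h
  have hX : algebraMap S L (MvPolynomial.X ⟨g i, hst ⟨i, rfl⟩⟩) = g i :=
    MvPolynomial.aeval_X _ _
  have hex : ∃ l, g l = g i := ⟨i, rfl⟩
  rw [hX, dif_pos hex] at h
  rw [h, hg.injective hex.choose_spec]

/-- If each `g i` is a simple root of a polynomial over the `x j`, the implicit partial derivatives
`D j i` of `g i` with respect to the `x j` have independent columns when the `g i` are
algebraically independent. -/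
theorem AlgebraicIndependent.eq_zero_of_implicit_derivatives {F L ι : Type*} [Field F] [CharZero F]
    [Field L] [Algebra F L] [Fintype ι] {k : ℕ} (x : Fin k → L) {g : ι → L}
    (hg : AlgebraicIndependent F g) (P : ι → MvPolynomial (Fin (k + 1)) F)
    (D : Fin k → ι → L)
    (hP : ∀ i, MvPolynomial.aeval (Fin.cons (g i) x : Fin (k + 1) → L) (P i) = 0)
    (hP' : ∀ i, MvPolynomial.aeval (Fin.cons (g i) x : Fin (k + 1) → L)
      (MvPolynomial.pderiv 0 (P i)) ≠ 0)
    (hD : ∀ i j, MvPolynomial.aeval (Fin.cons (g i) x : Fin (k + 1) → L)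
        (MvPolynomial.pderiv j.succ (P i)) +
      MvPolynomial.aeval (Fin.cons (g i) x : Fin (k + 1) → L)
        (MvPolynomial.pderiv 0 (P i)) * D j i = 0)
    (c : ι → L) (hc : ∀ j, ∑ i, c i * D j i = 0) : c = 0 := by
  classical
  -- Applying `δ` to `P i = 0` and dividing by the nonzero derivative at the simple root gives the
  -- chain rule.
  have key : ∀ (δ : Derivation F L L) (i : ι), δ (g i) = ∑ j, δ (x j) * D j i := by
    intro δ i
    have h := δ.map_mvPolynomial_aeval (Fin.cons (g i) x : Fin (k + 1) → L) (P i)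
    rw [hP, map_zero, Fin.sum_univ_succ] at h
    simp only [Fin.cons_zero, Fin.cons_succ] at h
    apply mul_left_cancel₀ (hP' i)
    rw [eq_neg_of_add_eq_zero_left h.symm, Finset.mul_sum, ← Finset.sum_neg_distrib]
    refine Finset.sum_congr rfl fun j _ => ?_
    rw [eq_neg_of_add_eq_zero_left (hD i j)]
    ring
  ext l
  -- A derivation dual to `g l` extracts `c l` from the column relation.
  obtain ⟨δ, hδ⟩ := hg.exists_derivation (Pi.single l 1 : ι → L)
  have h1 : ∑ i, c i * δ (g i) = c l := by
    simp [hδ, Pi.single_apply]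
  rw [← h1]
  simp only [key, Finset.mul_sum]
  rw [Finset.sum_comm]
  refine Finset.sum_eq_zero fun j _ => ?_
  calc ∑ i, c i * (δ (x j) * D j i) = δ (x j) * ∑ i, c i * D j i := by
        rw [Finset.mul_sum]
        exact Finset.sum_congr rfl fun i _ => by ring
    _ = 0 := by rw [hc, mul_zero]

/-! ### Simple roots over reduced rings -/

open Polynomial in
/-- In a reduced ring in which the nonzero elements of `R` are invertible, an algebraic element
is a root of a polynomial whose derivative takes an invertible value there. -/
theorem IsAlgebraic.exists_isUnit_aeval_derivative {R S : Type*} [CommRing R] [IsDomain R]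
    [CharZero R] [CommRing S] [IsReduced S] [Algebra R S]
    (hunit : ∀ r : R, r ≠ 0 → IsUnit (algebraMap R S r)) {z : S} (hz : IsAlgebraic R z) :
    ∃ P : R[X], aeval z P = 0 ∧ IsUnit (aeval z (derivative P)) := by
  classical
  let K := FractionRing R
  let ψ : K →+* S := IsLocalization.lift (M := nonZeroDivisors R) (g := algebraMap R S)
    fun r => hunit r (nonZeroDivisors.ne_zero r.2)
  have hψ : ψ.comp (algebraMap R K) = algebraMap R S := IsLocalization.lift_comp _
  obtain ⟨P, hP0, hP⟩ := hz
  have : CharZero K := charZero_of_injective_algebraMap (IsFractionRing.injective R K)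
  have hmap : ∀ Q : R[X], eval₂ ψ z (Q.map (algebraMap R K)) = aeval z Q := fun Q => by
    rw [eval₂_map, hψ, aeval_def]
  have hPK : P.map (algebraMap R K) ≠ 0 :=
    (Polynomial.map_ne_zero_iff (IsFractionRing.injective R K)).2 hP0
  -- `S` need not be a domain, so the radical replaces the minimal polynomial: `P` divides a power
  -- of `q` and vice versa up to radical, whence `q(z)` is nilpotent and so zero. Separability of
  -- `q` then gives a Bézout identity making `q'(z)` a unit.
  set q := UniqueFactorizationMonoid.radical (P.map (algebraMap R K)) with hq
  obtain ⟨N, hN⟩ := (UniqueFactorizationMonoid.exists_dvd_pow_iff_radical_dvd hPK).2 hq.symm.dvd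
  have hqz : eval₂ ψ z q = 0 := by
    obtain ⟨w, hw⟩ := hN
    have : eval₂ ψ z q ^ N = 0 := by
      rw [← eval₂_pow, hw, eval₂_mul, hmap, hP, zero_mul]
    exact eq_zero_of_pow_eq_zero this
  have hsep : q.Separable := PerfectField.separable_iff_squarefree.2
    UniqueFactorizationMonoid.squarefree_radical
  obtain ⟨a, b, hab⟩ := hsep
  obtain ⟨r, hr, hrq⟩ := IsLocalization.integerNormalization_spec (nonZeroDivisors R) q
  set Q := IsLocalization.integerNormalization (nonZeroDivisors R) q
  have hrunit : IsUnit (ψ (algebraMap R K r)) := by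
    rw [← RingHom.comp_apply, hψ]
    exact hunit r (nonZeroDivisors.ne_zero hr)
  have hrq' : Q.map (algebraMap R K) = C (algebraMap R K r) * q := by
    rw [hrq, ← algebraMap_smul K r q, smul_eq_C_mul]
  refine ⟨Q, ?_, ?_⟩
  · rw [← hmap, hrq', eval₂_mul, hqz, mul_zero]
  · rw [← hmap, ← derivative_map, hrq', derivative_C_mul, eval₂_mul, eval₂_C]
    refine hrunit.mul (IsUnit.of_mul_eq_one_right (eval₂ ψ z b) ?_)
    have := congrArg (eval₂ ψ z) hab
    rwa [eval₂_add, eval₂_mul, eval₂_mul, hqz, mul_zero, zero_add, eval₂_one] at this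

/-- Variable `0` carries the function value and the others the coordinates; this matches the two
forms of the simple-root condition. -/
theorem MvPolynomial.finSuccEquiv_pderiv_zero {R : Type*} [CommRing R] {k : ℕ}
    (p : MvPolynomial (Fin (k + 1)) R) :
    MvPolynomial.finSuccEquiv R k (MvPolynomial.pderiv 0 p) =
      Polynomial.derivative (MvPolynomial.finSuccEquiv R k p) := by
  induction p using MvPolynomial.induction_on with
  | C a => simp [MvPolynomial.finSuccEquiv_apply]
  | add p q hp hq => simp [hp, hq]
  | mul_X p i hp =>
    rw [Derivation.leibniz, map_add, smul_eq_mul, smul_eq_mul, map_mul, map_mul, hp, map_mul,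
      Polynomial.derivative_mul]
    refine Fin.cases ?_ (fun j => ?_) i
    · simp [MvPolynomial.finSuccEquiv_X_zero]
      ring
    · simp [MvPolynomial.finSuccEquiv_X_succ, MvPolynomial.pderiv_X]
      ring

/-! ### Rings of germs along a filter -/

open Filter in
/-- The ring of germs of real functions along a filter. -/
def GermRing {X : Type*} (l : Filter X) : Type _ := Germ l ℝ

namespace GermRing

noncomputable instance {X : Type*} (l : Filter X) : CommRing (GermRing l) :=
  inferInstanceAs (CommRing (Filter.Germ l ℝ))

/-- The germ of a function. -/
noncomputable def mkHom {X : Type*} (l : Filter X) : (X → ℝ) →+* GermRing l :=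
  Filter.Germ.coeRingHom l

noncomputable instance {X : Type*} (l : Filter X) : Algebra ℝ (GermRing l) :=
  ((mkHom l).comp (algebraMap ℝ (X → ℝ))).toAlgebra

/-- The germ of a function, as a homomorphism of algebras. -/
noncomputable def mk {X : Type*} (l : Filter X) : (X → ℝ) →ₐ[ℝ] GermRing l where
  __ := mkHom l
  commutes' _ := rfl

theorem mk_surjective {X : Type*} (l : Filter X) : Function.Surjective (mk l) :=
  Quotient.mk_surjective

theorem mk_eq_mk {X : Type*} {l : Filter X} {f g : X → ℝ} : mk l f = mk l g ↔ f =ᶠ[l] g :=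
  Filter.Germ.coe_eq

theorem mk_eq_zero {X : Type*} {l : Filter X} {f : X → ℝ} : mk l f = 0 ↔ ∀ᶠ x in l, f x = 0 := by
  rw [← map_zero (mk l), mk_eq_mk]
  rfl

theorem isUnit_mk {X : Type*} {l : Filter X} {f : X → ℝ} :
    IsUnit (mk l f) ↔ ∀ᶠ x in l, f x ≠ 0 := by
  constructor
  · intro h
    obtain ⟨z, hz⟩ := h.exists_right_inv
    obtain ⟨g, rfl⟩ := mk_surjective l z
    rw [← map_mul, ← map_one (mk l), mk_eq_mk] at hz
    filter_upwards [hz] with x hx h0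
    simp [h0] at hx
  · intro h
    refine IsUnit.of_mul_eq_one (mk l fun x => (f x)⁻¹) ?_
    rw [← map_mul, ← map_one (mk l), mk_eq_mk]
    filter_upwards [h] with x hx
    simp [hx]

instance {X : Type*} (l : Filter X) : IsReduced (GermRing l) where
  eq_zero z hz := by
    obtain ⟨N, hN⟩ := hz
    obtain ⟨f, rfl⟩ := mk_surjective l z
    rw [← map_pow, mk_eq_zero] at hN
    exact mk_eq_zero.2 (hN.mono fun x hx => eq_zero_of_pow_eq_zero hx)

/-- Along an ultrafilter a function is either eventually zero or eventually nonzero. -/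
theorem isField {X : Type*} (φ : Ultrafilter X) : IsField (GermRing (φ : Filter X)) where
  exists_pair_ne := ⟨0, 1, fun h => by
    rw [← map_zero (mk (φ : Filter X)), ← map_one (mk (φ : Filter X)), mk_eq_mk] at h
    obtain ⟨x, hx⟩ := h.exists
    simp at hx⟩
  mul_comm := mul_comm
  mul_inv_cancel {z} hz := by
    obtain ⟨f, rfl⟩ := mk_surjective _ z
    refine (isUnit_mk.2 ?_).exists_right_inv
    rw [Ne, mk_eq_zero] at hz
    exact Ultrafilter.eventually_not.2 hz

theorem mk_eval {X σ : Type*} (l : Filter X) (f : σ → X → ℝ) (p : MvPolynomial σ ℝ) :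
    mk l (fun x => MvPolynomial.eval (fun i => f i x) p) =
      MvPolynomial.aeval (fun i => mk l (f i)) p := by
  have h : (fun x => MvPolynomial.eval (fun i => f i x) p) = MvPolynomial.aeval f p := by
    ext x
    have := MvPolynomial.comp_aeval_apply f (Pi.evalAlgHom ℝ (fun _ : X => ℝ) x) p
    simpa [MvPolynomial.aeval_eq_eval] using this.symm
  rw [h, ← MvPolynomial.comp_aeval_apply]

/-- The germ of the `j`-th coordinate. -/
noncomputable def coord {k : ℕ} (l : Filter (Fin k → ℝ)) (j : Fin k) : GermRing l :=
  mk l fun x => x j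

theorem mk_eval_cons {k : ℕ} (l : Filter (Fin k → ℝ)) (h : (Fin k → ℝ) → ℝ)
    (p : MvPolynomial (Fin (k + 1)) ℝ) :
    mk l (fun x => MvPolynomial.eval (Fin.cons (h x) x : Fin (k + 1) → ℝ) p) =
      MvPolynomial.aeval (Fin.cons (mk l h) (coord l) : Fin (k + 1) → GermRing l) p := by
  have h1 : (Fin.cons (mk l h) (coord l) : Fin (k + 1) → GermRing l) =
      fun i => mk l ((Fin.cons h (fun j x => x j) : Fin (k + 1) → (Fin k → ℝ) → ℝ) i) := by
    ext i
    exact Fin.cases rfl (fun _ => rfl) i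
  rw [h1, ← mk_eval]
  congr 1
  ext x
  congr 2
  ext i
  exact Fin.cases rfl (fun _ => rfl) i

noncomputable instance {k : ℕ} (l : Filter (Fin k → ℝ)) :
    Algebra (MvPolynomial (Fin k) ℝ) (GermRing l) :=
  (MvPolynomial.aeval (coord l)).toAlgebra

theorem algebraMap_mvPolynomial {k : ℕ} (l : Filter (Fin k → ℝ)) (b : MvPolynomial (Fin k) ℝ) :
    algebraMap (MvPolynomial (Fin k) ℝ) (GermRing l) b = mk l fun x => MvPolynomial.eval x b :=
  (mk_eval l (fun j x => x j) b).symm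

theorem aeval_mk {k : ℕ} (l : Filter (Fin k → ℝ)) (h : (Fin k → ℝ) → ℝ)
    (P : Polynomial (MvPolynomial (Fin k) ℝ)) :
    Polynomial.aeval (mk l h) P =
      mk l fun x => (P.map (MvPolynomial.eval x)).eval (h x) := by
  induction P using Polynomial.induction_on' with
  | add P Q hP hQ =>
    rw [map_add, hP, hQ, ← map_add]
    congr 1
    ext x
    simp
  | monomial n a =>
    rw [Polynomial.aeval_monomial, algebraMap_mvPolynomial, ← map_pow, ← map_mul]
    congr 1
    ext x
    simp

theorem aeval_finSuccEquiv {k : ℕ} (l : Filter (Fin k → ℝ)) (h : (Fin k → ℝ) → ℝ)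
    (p : MvPolynomial (Fin (k + 1)) ℝ) :
    Polynomial.aeval (mk l h) (MvPolynomial.finSuccEquiv ℝ k p) =
      mk l fun x => MvPolynomial.eval (Fin.cons (h x) x : Fin (k + 1) → ℝ) p := by
  simp only [aeval_mk, MvPolynomial.eval_eq_eval_mv_eval']

end GermRing

/-! ### Generic points -/

/-- The filter of generic points of `U`: it is generated by the complements in `U` of the zero sets
of nonzero polynomials. -/
def genericFilter {k : ℕ} (U : Set (Fin k → ℝ)) : Filter (Fin k → ℝ) where
  sets := {s | ∃ b : MvPolynomial (Fin k) ℝ, b ≠ 0 ∧ ∀ x ∈ U, MvPolynomial.eval x b ≠ 0 → x ∈ s}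
  univ_sets := ⟨1, one_ne_zero, fun _ _ _ => Set.mem_univ _⟩
  sets_of_superset := fun ⟨b, hb, h⟩ hst => ⟨b, hb, fun x hx hbx => hst (h x hx hbx)⟩
  inter_sets := fun ⟨b, hb, h⟩ ⟨b', hb', h'⟩ => ⟨b * b', mul_ne_zero hb hb', fun x hx hbx => by
    rw [map_mul, mul_ne_zero_iff] at hbx
    exact ⟨h x hx hbx.1, h' x hx hbx.2⟩⟩

theorem eventually_genericFilter {k : ℕ} {U : Set (Fin k → ℝ)} {p : (Fin k → ℝ) → Prop} :
    (∀ᶠ x in genericFilter U, p x) ↔ ∃ b : MvPolynomial (Fin k) ℝ, b ≠ 0 ∧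
      ∀ x ∈ U, MvPolynomial.eval x b ≠ 0 → p x := Iff.rfl

theorem eventually_mem_genericFilter {k : ℕ} (U : Set (Fin k → ℝ)) :
    ∀ᶠ x in genericFilter U, x ∈ U :=
  eventually_genericFilter.2 ⟨1, one_ne_zero, fun _ hx _ => hx⟩

open Topology in
-- The basic generic sets are open, so generic identities may be differentiated.
theorem eventually_eventually_nhds_genericFilter {k : ℕ} {U : Set (Fin k → ℝ)} (hU : IsOpen U)
    {p : (Fin k → ℝ) → Prop} (h : ∀ᶠ x in genericFilter U, p x) :
    ∀ᶠ x in genericFilter U, ∀ᶠ y in 𝓝 x, p y := by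
  obtain ⟨b, hb, h⟩ := eventually_genericFilter.1 h
  refine eventually_genericFilter.2 ⟨b, hb, fun x hx hbx => ?_⟩
  filter_upwards [hU.mem_nhds hx, (MvPolynomial.continuous_eval b).continuousAt.eventually_ne hbx]
    with y hy hby using h y hy hby

open Topology in
theorem MvPolynomial.frequently_eval_ne_zero {k : ℕ} {b : MvPolynomial (Fin k) ℝ} (hb : b ≠ 0)
    (x : Fin k → ℝ) : ∃ᶠ y in 𝓝 x, MvPolynomial.eval y b ≠ 0 := by
  intro h
  rw [Filter.Eventually, nhds_pi, Filter.mem_pi'] at h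
  obtain ⟨I, s, hs, hsb⟩ := h
  refine hb (MvPolynomial.funext_set s (fun i => infinite_of_mem_nhds (x i) (hs i))
    fun y hy => ?_)
  rw [map_zero]
  exact not_not.1 (hsb (Set.pi_mono' (fun _ _ => subset_rfl) (Set.subset_univ _) hy))

/-- The nonvanishing set of a nonzero polynomial is dense. -/
theorem eqOn_zero_of_eventually_genericFilter {k : ℕ} {U : Set (Fin k → ℝ)} (hU : IsOpen U)
    {f : (Fin k → ℝ) → ℝ} (hf : ContinuousOn f U) (h : ∀ᶠ x in genericFilter U, f x = 0) :
    ∀ x ∈ U, f x = 0 := by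
  obtain ⟨b, hb, h⟩ := eventually_genericFilter.1 h
  intro x hx
  by_contra hfx
  have h1 := (hf.continuousAt (hU.mem_nhds hx)).eventually_ne hfx
  obtain ⟨y, hby, hfy, hy⟩ := ((MvPolynomial.frequently_eval_ne_zero hb x).and_eventually
    (h1.and (hU.mem_nhds hx))).exists
  exact hfy (h y hy hby)

theorem isUnit_algebraMap_genericFilter {k : ℕ} (U : Set (Fin k → ℝ))
    (b : MvPolynomial (Fin k) ℝ) (hb : b ≠ 0) :
    IsUnit (algebraMap (MvPolynomial (Fin k) ℝ) (GermRing (genericFilter U)) b) := by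
  rw [GermRing.algebraMap_mvPolynomial, GermRing.isUnit_mk]
  exact eventually_genericFilter.2 ⟨b, hb, fun _ _ h => h⟩

/-- `h` is generically on `U` a simple root of a polynomial with polynomial coefficients. -/
theorem IsAlgebraic.exists_simple_root {k : ℕ} {U : Set (Fin k → ℝ)} {h : (Fin k → ℝ) → ℝ}
    (hh : IsAlgebraic (MvPolynomial (Fin k) ℝ) (GermRing.mk (genericFilter U) h)) :
    ∃ p : MvPolynomial (Fin (k + 1)) ℝ,
      (∀ᶠ x in genericFilter U, MvPolynomial.eval (Fin.cons (h x) x : Fin (k + 1) → ℝ) p = 0) ∧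
      ∀ᶠ x in genericFilter U,
        MvPolynomial.eval (Fin.cons (h x) x : Fin (k + 1) → ℝ) (MvPolynomial.pderiv 0 p) ≠ 0 := by
  obtain ⟨P, hP, hP'⟩ := hh.exists_isUnit_aeval_derivative (isUnit_algebraMap_genericFilter U)
  obtain ⟨p, rfl⟩ := (MvPolynomial.finSuccEquiv ℝ k).surjective P
  rw [← MvPolynomial.finSuccEquiv_pderiv_zero, GermRing.aeval_finSuccEquiv,
    GermRing.isUnit_mk] at hP'
  rw [GermRing.aeval_finSuccEquiv, GermRing.mk_eq_zero] at hP
  exact ⟨p, hP, hP'⟩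

/-! ### Implicit differentiation of algebraic functions -/

theorem MvPolynomial.hasDerivAt_eval {σ : Type*} [Fintype σ] (p : MvPolynomial σ ℝ)
    {f : ℝ → σ → ℝ} {f' : σ → ℝ} {t : ℝ} (hf : ∀ i, HasDerivAt (fun s => f s i) (f' i) t) :
    HasDerivAt (fun s => MvPolynomial.eval (f s) p)
      (∑ i, MvPolynomial.eval (f t) (MvPolynomial.pderiv i p) * f' i) t := by
  classical
  induction p using MvPolynomial.induction_on with
  | C a => simpa using hasDerivAt_const t a
  | add p q hp hq =>
    simp only [map_add, add_mul, Finset.sum_add_distrib]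
    exact hp.fun_add hq
  | mul_X p i hp =>
    have h := hp.fun_mul (hf i)
    simp only [map_mul, MvPolynomial.eval_X]
    refine h.congr_deriv ?_
    simp only [MvPolynomial.pderiv_mul, MvPolynomial.pderiv_X, map_add, map_mul,
      MvPolynomial.eval_X, add_mul, Finset.sum_add_distrib, Finset.sum_mul, Pi.single_apply,
      apply_ite (MvPolynomial.eval (f t)), map_one, map_zero]
    congr 1
    · exact Finset.sum_congr rfl fun j _ => by ring
    · simp

/-- Differentiates the relation along the line in direction `j` only: intermediate spatial
derivatives need not be differentiable. -/
theorem implicit_lineDeriv {k : ℕ} {U : Set (Fin k → ℝ)} (hU : IsOpen U)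
    {h h' : (Fin k → ℝ) → ℝ} {j : Fin k} (p : MvPolynomial (Fin (k + 1)) ℝ)
    (hp : ∀ᶠ x in genericFilter U, MvPolynomial.eval (Fin.cons (h x) x : Fin (k + 1) → ℝ) p = 0)
    (hh : ∀ x ∈ U, HasLineDerivAt ℝ h (h' x) x (Pi.single j 1)) :
    ∀ᶠ x in genericFilter U,
      MvPolynomial.eval (Fin.cons (h x) x : Fin (k + 1) → ℝ) (MvPolynomial.pderiv j.succ p) +
      MvPolynomial.eval (Fin.cons (h x) x : Fin (k + 1) → ℝ) (MvPolynomial.pderiv 0 p) * h' x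
        = 0 := by
  filter_upwards [eventually_eventually_nhds_genericFilter hU hp, eventually_mem_genericFilter U]
    with x hx hxU
  have hcoord : ∀ i, HasDerivAt
      (fun s : ℝ => (Fin.cons (h (x + s • Pi.single j 1)) (x + s • Pi.single j 1) :
        Fin (k + 1) → ℝ) i)
      ((Fin.cons (h' x) (Pi.single j 1) : Fin (k + 1) → ℝ) i) 0 := by
    intro i
    refine Fin.cases ?_ (fun l => ?_) i
    · exact hh x hxU
    · have := ((hasDerivAt_id (0 : ℝ)).mul_const ((Pi.single j 1 : Fin k → ℝ) l)).const_add (x l)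
      simpa using this
  have hd := p.hasDerivAt_eval hcoord
  have hlim : Filter.Tendsto (fun s : ℝ => x + s • (Pi.single j 1 : Fin k → ℝ)) (nhds 0)
      (nhds x) := by
    have h1 : Filter.Tendsto (fun s : ℝ => x + s • (Pi.single j 1 : Fin k → ℝ)) (nhds 0)
        (nhds (x + (0 : ℝ) • (Pi.single j 1 : Fin k → ℝ))) :=
      (continuous_const.add (continuous_id.smul continuous_const)).tendsto 0
    rwa [zero_smul, add_zero] at h1
  have hzero := hd.unique ((hasDerivAt_const (0 : ℝ) (0 : ℝ)).congr_of_eventuallyEq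
    (hlim.eventually hx))
  rw [zero_smul, add_zero, Fin.sum_univ_succ, Finset.sum_eq_single j] at hzero
  · simpa [add_comm] using hzero
  · intro l _ hl
    simp [hl]
  · simp

/-- Partial derivatives of generically algebraic functions are generically algebraic. -/
theorem IsAlgebraic.lineDeriv {k : ℕ} {U : Set (Fin k → ℝ)} (hU : IsOpen U)
    {h h' : (Fin k → ℝ) → ℝ} {j : Fin k}
    (halg : IsAlgebraic (MvPolynomial (Fin k) ℝ) (GermRing.mk (genericFilter U) h))
    (hh : ∀ x ∈ U, HasLineDerivAt ℝ h (h' x) x (Pi.single j 1)) :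
    IsAlgebraic (MvPolynomial (Fin k) ℝ) (GermRing.mk (genericFilter U) h') := by
  obtain ⟨p, hp, hp'⟩ := halg.exists_simple_root
  have himp := implicit_lineDeriv hU p hp hh
  have hmem : ∀ q : MvPolynomial (Fin (k + 1)) ℝ, IsAlgebraic (MvPolynomial (Fin k) ℝ)
      (GermRing.mk (genericFilter U)
        fun x => MvPolynomial.eval (Fin.cons (h x) x : Fin (k + 1) → ℝ) q) := by
    intro q
    rw [← GermRing.aeval_finSuccEquiv]
    have hle : Algebra.adjoin (MvPolynomial (Fin k) ℝ) {GermRing.mk (genericFilter U) h} ≤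
        Subalgebra.algebraicClosure (MvPolynomial (Fin k) ℝ) (GermRing (genericFilter U)) :=
      Algebra.adjoin_le (Set.singleton_subset_iff.2 halg)
    exact hle (Polynomial.aeval_mem_adjoin_singleton _ _)
  have hunit := GermRing.isUnit_mk.2 hp'
  obtain ⟨hinv⟩ := hunit.nonempty_invertible
  -- The implicit equation solved for the derivative, whose coefficient is a unit by simplicity of
  -- the root.
  have heq : GermRing.mk (genericFilter U) h' = -(⅟(GermRing.mk (genericFilter U) fun x =>
      MvPolynomial.eval (Fin.cons (h x) x : Fin (k + 1) → ℝ) (MvPolynomial.pderiv 0 p)) *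
      GermRing.mk (genericFilter U) fun x =>
        MvPolynomial.eval (Fin.cons (h x) x : Fin (k + 1) → ℝ) (MvPolynomial.pderiv j.succ p)) := by
    apply hunit.mul_left_cancel
    rw [mul_neg, mul_invOf_cancel_left', eq_neg_iff_add_eq_zero, ← map_mul, ← map_add,
      GermRing.mk_eq_zero]
    filter_upwards [himp] with x hx
    rw [← hx]
    simp [add_comm]
  rw [heq]
  exact ((hmem _).invOf.mul (hmem _)).neg

theorem IsAlgebraicOn.isAlgebraic_mk {k : ℕ} {U : Set (Fin k → ℝ)} {f : (Fin k → ℝ) → ℝ}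
    (h : IsAlgebraicOn f U) :
    IsAlgebraic (MvPolynomial (Fin k) ℝ) (GermRing.mk (genericFilter U) f) := by
  obtain ⟨P, hP, hPf⟩ := h
  refine ⟨P, hP, ?_⟩
  rw [GermRing.aeval_mk, GermRing.mk_eq_zero]
  exact (eventually_mem_genericFilter U).mono hPf

theorem IsSpatialDeriv.isAlgebraic_mk {m : ℕ} {U : Set (Fin (m + 1) → ℝ)} (hU : IsOpen U)
    {u : (Fin (m + 1) → ℝ) → ℝ} (hu : IsAlgebraicOn u U) {α : Fin m → ℕ}
    {f : (Fin (m + 1) → ℝ) → ℝ} (hf : IsSpatialDeriv U u α f) :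
    IsAlgebraic (MvPolynomial (Fin (m + 1)) ℝ) (GermRing.mk (genericFilter U) f) := by
  induction hf with
  | zero => exact hu.isAlgebraic_mk
  | step α f g j _ hfg ih => exact ih.lineDeriv hU hfg

/-! ### From rank deficiency to a polynomial relation -/

/-- A property of sets stable under subsets and finite unions holds on a set of a filter as soon as
it holds on a set of each finer ultrafilter. -/
theorem Filter.exists_mem_of_forall_ultrafilter {X : Type*} {l : Filter X} {p : Set X → Prop}
    (he : p ∅) (hmono : ∀ t, p t → ∀ s ⊆ t, p s) (hunion : ∀ s, p s → ∀ t, p t → p (s ∪ t))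
    (h : ∀ φ : Ultrafilter X, ↑φ ≤ l → ∃ s ∈ φ, p s) : ∃ s ∈ l, p s := by
  -- An ultrafilter below both filters would contain a set with `p` together with its complement.
  by_cases hb : (l ⊓ Filter.comk p he hmono hunion).NeBot
  · obtain ⟨φ, hφ⟩ := Filter.exists_ultrafilter_iff.2 hb
    obtain ⟨s, hs, hps⟩ := h φ (hφ.trans inf_le_left)
    have hsc : sᶜ ∈ (φ : Filter X) :=
      (hφ.trans inf_le_right) (Filter.compl_mem_comk.2 hps)
    exact absurd hs (Ultrafilter.compl_mem_iff_notMem.1 hsc)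
  · rw [Filter.not_neBot, Filter.inf_eq_bot_iff] at hb
    obtain ⟨s, hs, t, ht, hst⟩ := hb
    exact ⟨s, hs, hmono _ ht _ (Set.disjoint_iff_inter_eq_empty.2 hst).subset_compl_right⟩

/-- A nonzero polynomial relation between differentiable generically algebraic functions whose
Jacobian is nowhere of full column rank, along an ultrafilter of generic points. -/
theorem exists_mem_ultrafilter_polynomial_relation {k n : ℕ} {U : Set (Fin k → ℝ)} (hU : IsOpen U)
    {G : Fin n → (Fin k → ℝ) → ℝ} (hG : ∀ i, DifferentiableOn ℝ (G i) U)
    (halg : ∀ i, IsAlgebraic (MvPolynomial (Fin k) ℝ) (GermRing.mk (genericFilter U) (G i)))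
    (hrank : ∀ p ∈ U, (jacobian G p).rank ≠ n) (φ : Ultrafilter (Fin k → ℝ))
    (hφ : (φ : Filter (Fin k → ℝ)) ≤ genericFilter U) :
    ∃ s ∈ φ, ∃ Q : MvPolynomial (Fin n) ℝ, Q ≠ 0 ∧
      ∀ x ∈ s, MvPolynomial.eval (fun i => G i x) Q = 0 := by
  classical
  choose P hP hP' using fun i => (halg i).exists_simple_root
  have hline : ∀ i j, ∀ x ∈ U,
      HasLineDerivAt ℝ (G i) (partialDeriv (G i) j x) x (Pi.single j 1) := fun i j x hx =>
    ((hG i).differentiableAt (hU.mem_nhds hx)).hasFDerivAt.hasLineDerivAt _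
  -- Kernel vectors are chosen pointwise without regularity; germs of arbitrary functions allow
  -- this.
  have hker : ∀ x, ∃ c : Fin n → ℝ, x ∈ U → c ≠ 0 ∧ (jacobian G x).mulVec c = 0 := by
    intro x
    by_cases hx : x ∈ U
    · obtain ⟨c, hc⟩ := (jacobian G x).exists_mulVec_eq_zero_of_rank_ne (hrank x hx)
      exact ⟨c, fun _ => hc⟩
    · exact ⟨0, fun h => absurd h hx⟩
  choose c hc using hker
  have hφU : ∀ᶠ x in (φ : Filter (Fin k → ℝ)), x ∈ U := hφ (eventually_mem_genericFilter U)
  let μ := GermRing.mk (φ : Filter (Fin k → ℝ))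
  have hdep : ¬ AlgebraicIndependent ℝ (fun i => μ (G i)) := by
    intro hind
    let := (GermRing.isField φ).toField
    have hzero := hind.eq_zero_of_implicit_derivatives (GermRing.coord (φ : Filter (Fin k → ℝ))) P
      (fun j i => μ (partialDeriv (G i) j))
      (fun i => by
        rw [← GermRing.mk_eval_cons, GermRing.mk_eq_zero]
        exact hφ (hP i))
      (fun i => by
        rw [← GermRing.mk_eval_cons, Ne, GermRing.mk_eq_zero]
        intro h
        obtain ⟨x, hx, hx'⟩ := (h.and (hφ (hP' i))).exists
        exact hx' hx)
      (fun i j => by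
        rw [← GermRing.mk_eval_cons, ← GermRing.mk_eval_cons, ← map_mul, ← map_add,
          GermRing.mk_eq_zero]
        exact hφ (implicit_lineDeriv hU (P i) (hP i) (hline i j)))
      (fun i => μ fun x => c x i)
      (fun j => by
        simp only [← map_mul, ← map_sum]
        rw [GermRing.mk_eq_zero]
        filter_upwards [hφU] with x hx
        have := congrFun (hc x hx).2 j
        simpa [Matrix.mulVec, dotProduct, jacobian, mul_comm] using this)
    have hall : ∀ᶠ x in (φ : Filter (Fin k → ℝ)), ∀ i, c x i = 0 :=
      Filter.eventually_all.2 fun i => GermRing.mk_eq_zero.1 (congrFun hzero i)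
    obtain ⟨x, hx, hxU⟩ := (hall.and hφU).exists
    exact (hc x hxU).1 (funext hx)
  rw [algebraicIndependent_iff] at hdep
  push Not at hdep
  obtain ⟨Q, hQ, hQ0⟩ := hdep
  rw [← GermRing.mk_eval, GermRing.mk_eq_zero] at hQ
  exact ⟨_, hQ, Q, hQ0, fun x hx => hx⟩

/-- The relation may depend on the ultrafilter, but products of relations handle finite unions.
Continuity then extends the generic relation to `U`. -/
theorem exists_polynomial_relation {k n : ℕ} {U : Set (Fin k → ℝ)} (hU : IsOpen U)
    {G : Fin n → (Fin k → ℝ) → ℝ} (hG : ∀ i, DifferentiableOn ℝ (G i) U)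
    (halg : ∀ i, IsAlgebraic (MvPolynomial (Fin k) ℝ) (GermRing.mk (genericFilter U) (G i)))
    (hrank : ∀ p ∈ U, (jacobian G p).rank ≠ n) :
    ∃ Q : MvPolynomial (Fin n) ℝ, Q ≠ 0 ∧
      ∀ x ∈ U, MvPolynomial.eval (fun i => G i x) Q = 0 := by
  obtain ⟨s, hs, Q, hQ, hQs⟩ := Filter.exists_mem_of_forall_ultrafilter (l := genericFilter U)
    (p := fun s => ∃ Q : MvPolynomial (Fin n) ℝ, Q ≠ 0 ∧
      ∀ x ∈ s, MvPolynomial.eval (fun i => G i x) Q = 0)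
    ⟨1, one_ne_zero, fun _ h => absurd h (Set.notMem_empty _)⟩
    (fun t ⟨Q, hQ, h⟩ s hst => ⟨Q, hQ, fun x hx => h x (hst hx)⟩)
    (fun s ⟨Q, hQ, h⟩ t ⟨Q', hQ', h'⟩ => ⟨Q * Q', mul_ne_zero hQ hQ', fun x hx => by
      rw [map_mul, mul_eq_zero]
      exact hx.imp (h x) (h' x)⟩)
    (exists_mem_ultrafilter_polynomial_relation hU hG halg hrank)
  refine ⟨Q, hQ, eqOn_zero_of_eventually_genericFilter hU ?_ (Filter.mem_of_superset hs hQs)⟩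
  exact (MvPolynomial.continuous_eval Q).comp_continuousOn
    (continuousOn_pi.2 fun i => (hG i).continuousOn)

/-! ### Uniqueness of algebraic PDEs and the main theorem -/

theorem add_eval_mem_algebraicClass {n : ℕ} {F : (Fin n → ℝ) → ℝ} (hF : F ∈ algebraicClass n)
    (Q : MvPolynomial (Fin n) ℝ) : (fun x => F x + MvPolynomial.eval x Q) ∈ algebraicClass n := by
  obtain ⟨hFa, P, hP, hPF⟩ := hF
  refine ⟨hFa.add (fun x _ => AnalyticOnNhd.eval_mvPolynomial Q x (Set.mem_univ x)),
    -- Subtracting `Q` from the last variable turns a polynomial for `F` into one for `F + Q`.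
    P.comp (Polynomial.X + Polynomial.C (-Q)), ?_, fun x hx => ?_⟩
  · exact Polynomial.comp_X_add_C_ne_zero_iff.2 hP
  · rw [Polynomial.map_comp, Polynomial.eval_comp]
    simpa using hPF x hx

/-- Uniqueness of an algebraic PDE with algebraic solution forces full rank of the Jacobian
somewhere. -/
theorem SolvesUniquePDE.exists_jacobian_rank_eq {m n : ℕ} {U : Set (Fin (m + 1) → ℝ)}
    (hU : IsOpen U) {u : (Fin (m + 1) → ℝ) → ℝ} (hu : IsAlgebraicOn u U) {α : Fin n → Fin m → ℕ}
    {G : Fin n → (Fin (m + 1) → ℝ) → ℝ} (hG : ∀ i, IsSpatialDeriv U u (α i) (G i))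
    (hGd : ∀ i, DifferentiableOn ℝ (G i) U) (h : SolvesUniquePDE (algebraicClass n) U u G) :
    ∃ p ∈ U, (jacobian G p).rank = n := by
  by_contra! hrank
  obtain ⟨Q, hQ, hQG⟩ := exists_polynomial_relation hU hGd
    (fun i => (hG i).isAlgebraic_mk hU hu) hrank
  obtain ⟨F, ⟨hF, hFu⟩, huniq⟩ := h
  -- Since `Q` vanishes along `G`, `F + Q` is another solution; uniqueness makes `Q` zero as a
  -- function, hence as a polynomial.
  have hFQ := huniq _ ⟨add_eval_mem_algebraicClass hF Q, fun p hp => by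
    rw [hQG p hp, add_zero]
    exact hFu p hp⟩
  refine hQ (MvPolynomial.funext fun x => ?_)
  simpa using congrFun hFQ x

theorem theorem3 {m n : ℕ} (hn : 0 < n)
    -- the function `u` on the open set `U`, the features `G = (u_{α_1}, …, u_{α_n})`
    (U : Set (Fin (m + 1) → ℝ)) (hU : IsOpen U)
    (u : (Fin (m + 1) → ℝ) → ℝ) (hu : ContDiffOn ℝ 1 u U)
    (α : Fin n → Fin m → ℕ) (G : Fin n → (Fin (m + 1) → ℝ) → ℝ)
    (hG : ∀ i, IsSpatialDeriv U u (α i) (G i))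
    (hGd : ∀ i, DifferentiableOn ℝ (G i) U)
    -- the data points, and the noisy Jacobian at the data points
    (D : Set (Fin (m + 1) → ℝ)) (hD : D ⊆ U)
    (Jt : (Fin (m + 1) → ℝ) → Matrix (Fin (m + 1)) (Fin n) ℝ)
    (ε C1low C1up : ℝ)
    (hlow : ∀ p ∈ D, C1low ≤ sigma (jacobian G p) 1)
    (hup : ∀ p ∈ D, sigma (jacobian G p) 1 ≤ C1up)
    (hε : ∀ p ∈ D, ‖jacobian G p - Jt p‖ ≤ ε) :
    -- the PDE is not unique
    ((SolvesNonuniquePDE (analyticClass n) U u G ∨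
        (IsAlgebraicOn u U ∧ SolvesNonuniquePDE (algebraicClass n) U u G)) →
      ε < C1low →
      ∀ p ∈ D, Jt p ≠ 0 ∧ rho (Jt p) ≤ ε / (C1low - ε)) ∧
    -- the PDE is algebraic and unique
    (∀ Cn : ℝ, IsAlgebraicOn u U → SolvesUniquePDE (algebraicClass n) U u G →
      ε < Cn →
      ((∃ p ∈ U, (jacobian G p).rank = n) → ∃ p ∈ D, Cn ≤ sigma (jacobian G p) n) →
      ∃ p ∈ D, Jt p ≠ 0 ∧ (Cn - ε) / (C1up + ε) ≤ rho (Jt p)) := by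

  refine ⟨fun h hεC p hp => ?_, fun Cn hua huniq hεC hCn => ?_⟩
  · have hrank : (jacobian G p).rank ≠ n := by
      rcases h with h | ⟨-, h⟩
      · exact h.jacobian_rank_ne hU hGd subset_rfl (hD hp)
      · exact h.jacobian_rank_ne hU hGd (fun _ hF => hF.1) (hD hp)
    exact rho_le_of_rank_ne hn hrank (hlow p hp) (hε p hp) hεC
  · obtain ⟨p, hp, hCp⟩ := hCn (huniq.exists_jacobian_rank_eq hU hua hG hGd)
    exact ⟨p, hp, le_rho_of_le_sigma_last hn hCp (hup p hp) (hε p hp) hεC⟩
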